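/- For a real Hilbert space \(\mathcal H\), let \(B(x,y)=x_0y_0-\langle x_{\mathcal H},y_{\mathcal H}\rangle\) on \(\mathbb R\oplus\mathcal H\). The hyperbolic space \(\mathbb H(\mathcal H)\) is \(\{x : x_0>0,\ B(x,x)=1\}\) with the distance \(d(x,y)=\cosh^{-1}B(x,y)\). Its boundary \(\partial_\infty\mathbb H(\mathcal H)\) is the set of isotropic lines of \(B\), and the boundary and the union \(\overline{\mathbb H}=\mathbb H\cup\partial_\infty\mathbb H\) (lines on which \(B\ge 0\)) carry the topology of subspaces of the projective space \(\mathrm P(\mathbb R\oplus\mathcal H)\). Write \(\mathbb H^n=\mathbb H(\mathbb R^n)\), and \(\mathbb H^\infty=\mathbb H(\mathcal H)\) for a separable infinite-dimensional \(\mathcal H\). The visual distance on \(\partial_\infty\mathbb H^\infty\) based at \(p\in\mathbb H^\infty\) is \(D_p(\zeta,\eta)=\sin\big(\tfrac12\angle_p(\zeta,\eta)\big)\), where \(\angle_p(\zeta,\eta)\in[0,\pi]\) is the angle at \(p\) between the geodesic rays from \(p\) towards \(\zeta\) and \(\eta\). An exotic representation is a homomorphism \(\rho:\operatorname{Isom}(\mathbb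 H^n)\to\operatorname{Isom}(\mathbb H^\infty)\) that is continuous (\(g\mapsto\rho(g)y\) is continuous for every \(y\)) and irreducible (it preserves no proper hyperbolic subspace of \(\mathbb H^\infty\)). **Proposition.** Let \(n\ge 2\), let \(0<t<1\), let \(\rho:\operatorname{Isom}(\mathbb H^n)\to\operatorname{Isom}(\mathbb H^\infty)\) be an exotic representation, and let \(f=f^n_t:\mathbb H^n\to\mathbb H^\infty\) be an orbit map of \(\rho\), i.e. \(f(gx)=\rho(g)f(x)\) for all \(g\in\operatorname{Isom}(\mathbb H^n)\), \(x\in\mathbb H^n\), such that for some constant \(C\) \[\big|d_{\mathbb H^\infty}(f(x),f(y))-t\,d_{\mathbb H^n}(x,y)\big|\le C\qquad\text{for all }x,y\in\mathbb H^n .\] Then \(f\) extends to a continuous map \(\overline{\mathbb H^n}\to\overline{\mathbb H^\infty}\) which restricts to a topological embedding \(\partial f:\partial_\infty\mathbb H^n\hookrightarrow\partial_\infty\mathbb H^\infty\). Moreover, for every base point \(p\in\mathbb H^\infty\), the Hausdorff dimension of \(\partial f(\partial_\infty\mathbb H^n)\) with respect to the visual distance \(D_p\) is \(\frac{n-1}{t}\).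 -/

import Mathlib

open Topology

noncomputable section

namespace Hyperbolic

variable {H : Type*} [NormedAddCommGroup H] [InnerProductSpace ℝ H]

/-! ## The Lorentzian form and the hyperboloid model -/

/-- The Lorentzian form `B(x, y) = x₀ y₀ - ⟪x_H, y_H⟫` on `ℝ ⊕ H`. -/
def lorentz (x y : ℝ × H) : ℝ := x.1 * y.1 - inner ℝ x.2 y.2

/-- The hyperboloid model of the real hyperbolic space of dimension `dim H`: the vectors
`x ∈ ℝ ⊕ H` with `x₀ > 0` and `B(x, x) = 1`. -/
@[ext]
structure Hyp (H : Type*) [NormedAddCommGroup H] [InnerProductSpace ℝ H] where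
  vec : ℝ × H
  time_pos : 0 < vec.1
  lorentz_self : lorentz vec vec = 1

/-- The boundary at infinity of `Hyp H`: the isotropic lines of `ℝ ⊕ H`.  Such a line is
represented by its unique vector `v` with `v₀ = 1`. -/
@[ext]
structure Boundary (H : Type*) [NormedAddCommGroup H] [InnerProductSpace ℝ H] where
  vec : ℝ × H
  time_eq_one : vec.1 = 1
  lorentz_self : lorentz vec vec = 0

/-- The hyperbolic space together with its boundary at infinity: the lines of `ℝ ⊕ H` on which
`B ≥ 0`.  Such a line is represented by its unique vector `v` with `v₀ = 1`. -/
@[ext]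
structure Compactification (H : Type*) [NormedAddCommGroup H] [InnerProductSpace ℝ H] where
  vec : ℝ × H
  time_eq_one : vec.1 = 1
  lorentz_self_nonneg : 0 ≤ lorentz vec vec

/-- The topology of the boundary, as a subspace of the projective space of `ℝ ⊕ H`
(in the affine chart `v₀ = 1`). -/
instance : TopologicalSpace (Boundary H) :=
  TopologicalSpace.induced Boundary.vec inferInstance

/-- The topology of the compactification, as a subspace of the projective space of `ℝ ⊕ H`
(in the affine chart `v₀ = 1`). -/
instance : TopologicalSpace (Compactification H) :=
  TopologicalSpace.induced Compactification.vec inferInstance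

/-! ### Elementary facts on the Lorentzian form -/

lemma lorentz_comm (x y : ℝ × H) : lorentz x y = lorentz y x := by
  simp only [lorentz, real_inner_comm, mul_comm]

lemma lorentz_sub_left (x y z : ℝ × H) : lorentz (x - y) z = lorentz x z - lorentz y z := by
  simp only [lorentz, Prod.fst_sub, Prod.snd_sub, inner_sub_left]; ring

lemma lorentz_sub_right (x y z : ℝ × H) : lorentz x (y - z) = lorentz x y - lorentz x z := by
  simp only [lorentz, Prod.fst_sub, Prod.snd_sub, inner_sub_right]; ring

lemma lorentz_smul_left (a : ℝ) (x y : ℝ × H) : lorentz (a • x) y = a * lorentz x y := by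
  simp only [lorentz, Prod.smul_fst, Prod.smul_snd, inner_smul_left, smul_eq_mul, conj_trivial]
  ring

lemma lorentz_smul_right (a : ℝ) (x y : ℝ × H) : lorentz x (a • y) = a * lorentz x y := by
  rw [lorentz_comm, lorentz_smul_left, lorentz_comm]

/-- Lines on which `B ≥ 0` meet the affine chart `v₀ = 1`: every nonzero
vector with `B(x, x) ≥ 0` has `x₀ ≠ 0`, so its line has a unique vector with `v₀ = 1`. -/
lemma time_ne_zero {x : ℝ × H} (hx : x ≠ 0) (h : 0 ≤ lorentz x x) : x.1 ≠ 0 := by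
  intro h0
  apply hx
  have h1 : inner ℝ x.2 x.2 ≤ (0 : ℝ) := by
    simp only [lorentz, h0] at h; linarith
  rw [real_inner_self_eq_norm_sq] at h1
  have h2 : ‖x.2‖ = 0 := by nlinarith [norm_nonneg x.2]
  exact Prod.ext h0 (norm_eq_zero.1 h2)

lemma Hyp.norm_sq (p : Hyp H) : ‖p.vec.2‖ ^ 2 = p.vec.1 ^ 2 - 1 := by
  have h := p.lorentz_self
  simp only [lorentz, real_inner_self_eq_norm_sq] at h
  linarith

/-- `-B` is nonnegative on the orthogonal of a point of the hyperboloid. -/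
lemma lorentz_self_nonpos (p : Hyp H) {w : ℝ × H} (hw : lorentz w p.vec = 0) :
    lorentz w w ≤ 0 ∧ (lorentz w w = 0 → w = 0) := by
  have hp := p.norm_sq
  have hpos := p.time_pos
  have h1 : w.1 * p.vec.1 = inner ℝ w.2 p.vec.2 := by
    simp only [lorentz] at hw; linarith
  have h2 : (w.1 * p.vec.1) ^ 2 ≤ ‖w.2‖ ^ 2 * ‖p.vec.2‖ ^ 2 := by
    rw [h1, ← mul_pow]
    exact sq_le_sq' (neg_le_of_abs_le (abs_real_inner_le_norm _ _)) (real_inner_le_norm _ _)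
  rw [hp] at h2
  have h3 : p.vec.1 ^ 2 * lorentz w w ≤ - ‖w.2‖ ^ 2 := by
    simp only [lorentz, real_inner_self_eq_norm_sq]; nlinarith
  have hp2 : 0 < p.vec.1 ^ 2 := by positivity
  refine ⟨?_, fun h0 => ?_⟩
  · nlinarith [sq_nonneg ‖w.2‖]
  · rw [h0] at h3
    have h4 : ‖w.2‖ = 0 := by nlinarith [norm_nonneg w.2, sq_nonneg ‖w.2‖]
    have h5 : w.2 = 0 := norm_eq_zero.1 h4
    have h6 : w.1 = 0 := by
      rw [h5, inner_zero_left] at h1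
      exact (mul_eq_zero.1 h1).resolve_right hpos.ne'
    exact Prod.ext h6 h5

/-- Cauchy–Schwarz for `-B` on the orthogonal of a point of the hyperboloid. -/
lemma lorentz_cauchy_schwarz (p : Hyp H) {a b : ℝ × H} (ha : lorentz a p.vec = 0)
    (hb : lorentz b p.vec = 0) : lorentz a b ^ 2 ≤ lorentz a a * lorentz b b := by
  obtain ⟨hb1, hb2⟩ := lorentz_self_nonpos p hb
  rcases hb1.eq_or_lt with h0 | h0
  · have : b = 0 := hb2 h0
    simp [this, lorentz]
  · have hw : lorentz (lorentz b b • a - lorentz a b • b) p.vec = 0 := by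
      simp [lorentz_sub_left, lorentz_smul_left, ha, hb]
    have h := (lorentz_self_nonpos p hw).1
    simp only [lorentz_sub_left, lorentz_smul_left, lorentz_sub_right, lorentz_smul_right,
      lorentz_comm b a] at h
    have h' : lorentz b b * (lorentz b b * lorentz a a - lorentz a b ^ 2) ≤ 0 := by
      nlinarith
    by_contra hcon
    push Not at hcon
    nlinarith

lemma one_le_lorentz (x y : Hyp H) : 1 ≤ lorentz x.vec y.vec := by
  have hx := x.norm_sq
  have hy := y.norm_sq
  have h1 : inner ℝ x.vec.2 y.vec.2 ≤ ‖x.vec.2‖ * ‖y.vec.2‖ := real_inner_le_norm _ _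
  have hX := x.time_pos
  have hY := y.time_pos
  have h2 : ‖x.vec.2‖ * ‖y.vec.2‖ ≤ x.vec.1 * y.vec.1 - 1 := by
    have h3 : 1 ≤ x.vec.1 * y.vec.1 := by
      have : 1 ≤ x.vec.1 := by nlinarith [sq_nonneg ‖x.vec.2‖]
      have : 1 ≤ y.vec.1 := by nlinarith [sq_nonneg ‖y.vec.2‖]
      nlinarith
    refine abs_le_of_sq_le_sq' ?_ (by linarith) |>.2
    rw [mul_pow, hx, hy]
    nlinarith [sq_nonneg (x.vec.1 - y.vec.1)]
  simp only [lorentz]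
  linarith

lemma lorentz_orth (x p : Hyp H) :
    lorentz (x.vec - lorentz x.vec p.vec • p.vec) p.vec = 0 := by
  simp [lorentz_sub_left, lorentz_smul_left, p.lorentz_self]

lemma lorentz_triangle (x y z : Hyp H) :
    lorentz x.vec z.vec ≤ lorentz x.vec y.vec * lorentz y.vec z.vec +
      √(lorentz x.vec y.vec ^ 2 - 1) * √(lorentz y.vec z.vec ^ 2 - 1) := by
  have h := lorentz_cauchy_schwarz y (lorentz_orth x y) (lorentz_orth z y)
  simp only [lorentz_sub_left, lorentz_smul_left, lorentz_sub_right, lorentz_smul_right,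
    x.lorentz_self, y.lorentz_self, z.lorentz_self, lorentz_comm y.vec x.vec,
    lorentz_comm z.vec y.vec] at h
  have hxy := one_le_lorentz x y
  have hyz := one_le_lorentz y z
  rw [← Real.sqrt_mul (by nlinarith)]
  have h2 : lorentz x.vec z.vec - lorentz x.vec y.vec * lorentz y.vec z.vec ≤
      √((lorentz x.vec y.vec ^ 2 - 1) * (lorentz y.vec z.vec ^ 2 - 1)) := by
    apply Real.le_sqrt_of_sq_le
    nlinarith
  linarith

/-! ## The hyperbolic distance -/

/-- The hyperbolic distance `d(x, y) = arcosh B(x, y)`. -/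
instance : MetricSpace (Hyp H) where
  dist x y := Real.arcosh (lorentz x.vec y.vec)
  dist_self x := by simp [x.lorentz_self]
  dist_comm x y := by rw [lorentz_comm]
  dist_triangle x y z := by
    have hxy := one_le_lorentz x y
    have hyz := one_le_lorentz y z
    have hxz := one_le_lorentz x z
    have h0 : 0 ≤ Real.arcosh (lorentz x.vec y.vec) + Real.arcosh (lorentz y.vec z.vec) :=
      add_nonneg (Real.arcosh_nonneg hxy) (Real.arcosh_nonneg hyz)
    rw [← Real.arcosh_cosh h0, Real.arcosh_le_arcosh (by linarith) (Real.cosh_pos _),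
      Real.cosh_add, Real.cosh_arcosh hxy, Real.cosh_arcosh hyz, Real.sinh_arcosh hxy,
      Real.sinh_arcosh hyz]
    exact lorentz_triangle x y z
  eq_of_dist_eq_zero := by
    intro x y h
    have h1 : lorentz x.vec y.vec = 1 := (Real.arcosh_eq_zero_iff (one_le_lorentz x y)).1 h
    have h2 := lorentz_orth x y
    rw [h1, one_smul] at h2
    have h3 : lorentz (x.vec - y.vec) (x.vec - y.vec) = 0 := by
      simp only [lorentz_sub_left, lorentz_sub_right, x.lorentz_self, y.lorentz_self,
        lorentz_comm y.vec x.vec, h1]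
      ring
    exact Hyp.ext (sub_eq_zero.1 ((lorentz_self_nonpos y h2).2 h3))

/-! ## The compactification -/

/-- A point `x` of the hyperbolic space, seen as the line `[x]` of the compactification. -/
def Hyp.toCompactification (x : Hyp H) : Compactification H where
  vec := x.vec.1⁻¹ • x.vec
  time_eq_one := by simp [x.time_pos.ne']
  lorentz_self_nonneg := by
    rw [lorentz_smul_left, lorentz_smul_right, x.lorentz_self]
    have := x.time_pos
    positivity

/-- A point of the boundary, seen in the compactification. -/
def Boundary.toCompactification (ξ : Boundary H) : Compactification H where
  vec := ξ.vec
  time_eq_one := ξ.time_eq_one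
  lorentz_self_nonneg := ξ.lorentz_self.ge

/-! ## Visual distances and Hausdorff dimension -/

/-- The unit tangent vector at `p` of the geodesic ray from `p` towards the isotropic line
`ξ = [v]`: it is `u = v / B(v, p) - p`, and the ray is `s ↦ cosh s • p + sinh s • u`. -/
def direction (p : Hyp H) (ξ : Boundary H) : ℝ × H :=
  (lorentz ξ.vec p.vec)⁻¹ • ξ.vec - p.vec

/-- The angle in `[0, π]` at `p` between the geodesic rays from `p` towards `ξ` and `η`, for the
Riemannian metric (the restriction of `-B` to the tangent spaces of the hyperboloid). -/
def angle (p : Hyp H) (ξ η : Boundary H) : ℝ :=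
  Real.arccos (-lorentz (direction p ξ) (direction p η))

/-- The visual distance `sin (∠_p(ξ, η) / 2)` on the boundary, based at `p`. -/
def visualDist (p : Hyp H) (ξ η : Boundary H) : ℝ := Real.sin (angle p ξ η / 2)

lemma lorentz_boundary_pos (p : Hyp H) (ξ : Boundary H) : 0 < lorentz ξ.vec p.vec := by
  have hp := p.norm_sq
  have hpos := p.time_pos
  have hξ := ξ.lorentz_self
  simp only [lorentz, real_inner_self_eq_norm_sq, ξ.time_eq_one] at hξ
  have h1 : ‖ξ.vec.2‖ = 1 := by nlinarith [norm_nonneg ξ.vec.2]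
  have h2 : inner ℝ ξ.vec.2 p.vec.2 ≤ ‖ξ.vec.2‖ * ‖p.vec.2‖ := real_inner_le_norm _ _
  have h3 : ‖p.vec.2‖ < p.vec.1 := by
    apply lt_of_pow_lt_pow_left₀ 2 hpos.le
    linarith
  simp only [lorentz, ξ.time_eq_one]
  rw [h1] at h2
  linarith

lemma lorentz_direction_base (p : Hyp H) (ξ : Boundary H) :
    lorentz (direction p ξ) p.vec = 0 := by
  simp [direction, lorentz_sub_left, lorentz_smul_left, p.lorentz_self,
    (lorentz_boundary_pos p ξ).ne']

lemma lorentz_direction_self (p : Hyp H) (ξ : Boundary H) :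
    lorentz (direction p ξ) (direction p ξ) = -1 := by
  have h := (lorentz_boundary_pos p ξ).ne'
  simp only [direction, lorentz_sub_left, lorentz_smul_left, lorentz_sub_right,
    lorentz_smul_right, p.lorentz_self, ξ.lorentz_self, lorentz_comm p.vec ξ.vec]
  field_simp
  ring

lemma direction_injective (p : Hyp H) : Function.Injective (direction p) := by
  intro ξ η h
  have h1 := sub_left_injective h
  have h2 := congrArg Prod.fst h1
  simp only [Prod.smul_fst, ξ.time_eq_one, η.time_eq_one, smul_eq_mul, mul_one] at h2
  simp only [h2] at h1
  exact Boundary.ext (smul_right_injective _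
    (inv_ne_zero (lorentz_boundary_pos p η).ne') h1)

lemma visualDist_eq (p : Hyp H) (ξ η : Boundary H) :
    visualDist p ξ η = √(-lorentz (direction p ξ - direction p η)
      (direction p ξ - direction p η)) / 2 := by
  have hcs := lorentz_cauchy_schwarz p (lorentz_direction_base p ξ) (lorentz_direction_base p η)
  rw [lorentz_direction_self, lorentz_direction_self] at hcs
  have h := abs_le_of_sq_le_sq' (a := lorentz (direction p ξ) (direction p η)) (b := 1)
    (by linarith) zero_le_one
  rw [visualDist, angle, Real.sin_half_eq_sqrt (Real.arccos_nonneg _)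
    (by linarith [Real.arccos_le_pi (-lorentz (direction p ξ) (direction p η)), Real.pi_pos]),
    Real.cos_arccos (by linarith) (by linarith)]
  have h2 : -lorentz (direction p ξ - direction p η) (direction p ξ - direction p η) =
      2 ^ 2 * ((1 - -lorentz (direction p ξ) (direction p η)) / 2) := by
    simp only [lorentz_sub_left, lorentz_sub_right, lorentz_direction_self,
      lorentz_comm (direction p η) (direction p ξ)]
    ring
  rw [h2, Real.sqrt_mul (by norm_num), Real.sqrt_sq (by norm_num)]
  ring

/-- The visual distance based at `p` is a distance on the boundary. -/
abbrev visualMetric (p : Hyp H) : MetricSpace (Boundary H) where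
  dist := visualDist p
  dist_self ξ := by rw [visualDist_eq]; simp [lorentz]
  dist_comm ξ η := by rw [visualDist, visualDist, angle, angle, lorentz_comm]
  dist_triangle ξ η ζ := by
    simp only [visualDist_eq]
    have key : ∀ a b : ℝ × H, lorentz a p.vec = 0 → lorentz b p.vec = 0 →
        √(-lorentz (a - b) (a - b)) ≤ √(-lorentz a a) + √(-lorentz b b) := by
      intro a b ha hb
      have hcs := lorentz_cauchy_schwarz p ha hb
      have ha' := (lorentz_self_nonpos p ha).1
      have hb' := (lorentz_self_nonpos p hb).1
      rw [Real.sqrt_le_left (by positivity), add_sq, Real.sq_sqrt (by linarith),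
        Real.sq_sqrt (by linarith), mul_assoc, ← Real.sqrt_mul (by linarith)]
      have h2 : lorentz a b ≤ √(-lorentz a a * -lorentz b b) :=
        Real.le_sqrt_of_sq_le (by linarith)
      simp only [lorentz_sub_left, lorentz_sub_right, lorentz_comm b a]
      linarith
    have h := key (direction p ξ - direction p η) (direction p ζ - direction p η)
      (by simp [lorentz_sub_left, lorentz_direction_base])
      (by simp [lorentz_sub_left, lorentz_direction_base])
    rw [sub_sub_sub_cancel_right] at h
    have h2 : lorentz (direction p η - direction p ζ) (direction p η - direction p ζ) =
        lorentz (direction p ζ - direction p η) (direction p ζ - direction p η) := by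
      simp only [lorentz_sub_left, lorentz_sub_right]; ring
    rw [h2]
    linarith
  eq_of_dist_eq_zero := by
    intro ξ η h
    change visualDist p ξ η = 0 at h
    have hw : lorentz (direction p ξ - direction p η) p.vec = 0 := by
      simp [lorentz_sub_left, lorentz_direction_base]
    obtain ⟨h1, h2⟩ := lorentz_self_nonpos p hw
    rw [visualDist_eq, div_eq_zero_iff, Real.sqrt_eq_zero (by linarith)] at h
    apply direction_injective p
    refine sub_eq_zero.1 (h2 ?_)
    rcases h with h | h
    · linarith
    · norm_num at h

/-- The Hausdorff dimension of a subset of the boundary for the visual distance based at `p`. -/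
def visualHausdorffDim (p : Hyp H) (S : Set (Boundary H)) : ENNReal :=
  @dimH (Boundary H) (visualMetric p).toEMetricSpace S

/-! ## Exotic representations -/

/-- The topology of pointwise convergence on the isometry group of a metric space. -/
abbrev isometryTopology (X : Type*) [MetricSpace X] : TopologicalSpace (X ≃ᵢ X) :=
  TopologicalSpace.induced (fun g x => g x) Pi.topologicalSpace

/-- An exotic representation: a continuous irreducible representation of `Isom(Hyp K)` into
`Isom(Hyp H)`.  Continuity means that all orbit maps `g ↦ ρ(g) y` are continuous; irreducibility
means that no hyperbolic subspace of `Hyp H` (a nonempty intersection of `Hyp H` with a closed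
linear subspace `V` of `ℝ ⊕ H`) other than `Hyp H` itself is preserved. -/
structure IsExotic {K : Type*} [NormedAddCommGroup K] [InnerProductSpace ℝ K]
    (ρ : (Hyp K ≃ᵢ Hyp K) →* (Hyp H ≃ᵢ Hyp H)) : Prop where
  continuous_orbit : ∀ y : Hyp H,
    Continuous[isometryTopology (Hyp K), inferInstance] fun g => ρ g y
  irreducible : ∀ V : Submodule ℝ (ℝ × H), IsClosed (V : Set (ℝ × H)) →
    (∃ x : Hyp H, x.vec ∈ V) →
    (∀ (g : Hyp K ≃ᵢ Hyp K) (x : Hyp H), x.vec ∈ V → (ρ g x).vec ∈ V) →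
    ∀ x : Hyp H, x.vec ∈ V

/-- `f` is an orbit map of `ρ`: it is of the form `g o ↦ ρ(g) f(o)`, i.e. `ρ`-equivariant. -/
def IsOrbitMap {K : Type*} [NormedAddCommGroup K] [InnerProductSpace ℝ K]
    (ρ : (Hyp K ≃ᵢ Hyp K) →* (Hyp H ≃ᵢ Hyp H)) (f : Hyp K → Hyp H) : Prop :=
  ∀ (g : Hyp K ≃ᵢ Hyp K) (x : Hyp K), f (g x) = ρ g (f x)

end Hyperbolic

end

/-!
In the affine chart `v₀ = 1` the compactification of the hyperbolic space is the closed unit ball,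
the boundary is the unit sphere, and two points `a`, `b` of the ball satisfy
`‖a - b‖² = 2 B(a, b) - B(a, a) - B(b, b)` with all three values of `B` nonnegative. For points
`x`, `y` of the hyperboloid, `B([x], [y]) = B(x, y) / (x₀ y₀)`, where `B(x, y) = cosh d(x, y)` and
where `x₀ = cosh d(x, o)` for the origin `o = (1, 0)`. Hence a map `f` with `|d(f x, f y) - t d(x, y)|`
bounded satisfies

  `A⁻¹ B([x], [y]) ^ t ≤ B([f x], [f y]) ≤ A B([x], [y]) ^ t`

for some constant `A` (`exists_lorentz_comparison`). As `B([x], [y])` tends to `0` when `[x]` and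
`[y]` tend to the same boundary point, the upper bound shows that `f` extends to the boundary, with
the same comparison in the limit, and that the extension is continuous at boundary points
(`exists_continuous_extension`). At interior points, continuity is that of `f`, which follows from
the continuity of the representation by moving points with central symmetries
(`IsOrbitMap.continuous`).

On the boundary `B(ξ, η) = ‖ξ - η‖² / 2`, and every visual distance is comparable to the square
root of `B` (`exists_visualDist_comparison`). The boundary map `φ` thus satisfies
`D_p(φ ξ, φ η) ≍ ‖ξ - η‖ ^ t`: it is an embedding (`isEmbedding_of_lorentz_comparison`), and it
divides by `t` the Hausdorff dimension of the unit sphere (`visualHausdorffDim_range`), which is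
`n - 1` (`dimH_unitSphere`).
-/

open Topology

noncomputable section

namespace Hyperbolic

/-! ### Hausdorff dimension of spheres and of Hölder reparametrizations -/

open Module in
/-- The upper bound comes from the stereographic parametrization of the sphere minus a point, the
lower bound from the orthogonal projection to a hyperplane, which maps the sphere onto the unit
ball. -/
lemma dimH_unitSphere {E : Type*} [NormedAddCommGroup E] [InnerProductSpace ℝ E]
    [FiniteDimensional ℝ E] (m : ℕ) (hE : finrank ℝ E = m + 1) :
    dimH (Metric.sphere (0 : E) 1) = m := by
  have : Fact (finrank ℝ E = m + 1) := ⟨hE⟩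
  have : Nontrivial E := Module.nontrivial_of_finrank_pos (R := ℝ) (by omega)
  obtain ⟨v, hv⟩ := exists_norm_eq E zero_le_one
  have hv0 : v ≠ 0 := by rintro rfl; simp at hv
  have hfin : finrank ℝ (ℝ ∙ v)ᗮ = m := Submodule.finrank_orthogonal_span_singleton hv0
  apply le_antisymm
  · have hsub : Metric.sphere (0 : E) 1 ⊆
        Set.range (fun w : (ℝ ∙ v)ᗮ => stereoInvFunAux v (w : E)) ∪ {v} := by
      intro x hx
      by_cases hxv : x = v
      · exact Or.inr hxv
      · left
        have h := stereo_left_inv hv (x := ⟨x, hx⟩) hxv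
        exact ⟨stereoToFun v x, congrArg Subtype.val h⟩
    refine (dimH_mono hsub).trans ?_
    rw [dimH_union, dimH_singleton, max_eq_left zero_le, ← hfin]
    exact ContDiff.dimH_range_le
      (contDiff_stereoInvFunAux.comp ((ℝ ∙ v)ᗮ.subtypeL.contDiff))
  · rw [← hfin, ← Real.dimH_of_mem_nhds (Metric.ball_mem_nhds (0 : (ℝ ∙ v)ᗮ) one_pos)]
    refine (dimH_mono ?_).trans
      (dimH_orthogonalProjectionOnto_le (𝕜 := ℝ) (ℝ ∙ v)ᗮ (Metric.sphere (0 : E) 1))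
    intro w hw
    have hw1 : ‖w‖ < 1 := by simpa using hw
    have hwv : inner ℝ (w : E) v = 0 := Submodule.mem_orthogonal_singleton_iff_inner_left.1 w.2
    have h1 : 0 ≤ 1 - ‖w‖ ^ 2 := by nlinarith [norm_nonneg w]
    refine ⟨(w : E) + √(1 - ‖w‖ ^ 2) • v, ?_, ?_⟩
    · rw [mem_sphere_zero_iff_norm, ← sq_eq_sq₀ (norm_nonneg _) zero_le_one, norm_add_sq_real,
        inner_smul_right, hwv, norm_smul, hv, Real.norm_eq_abs, mul_one, sq_abs,
        Real.sq_sqrt h1, Submodule.coe_norm]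
      ring
    · rw [map_add, map_smul, Submodule.orthogonalProjectionOnto_mem_subspace_eq_self]
      have : (ℝ ∙ v)ᗮ.orthogonalProjectionOnto v = 0 := by
        apply Submodule.orthogonalProjectionOnto_eq_zero_iff.2
        exact Submodule.le_orthogonal_orthogonal _ (Submodule.mem_span_singleton_self v)
      rw [this, smul_zero, add_zero]

/-- If `b` is an `r`-Hölder function of `a`, then its range has at most `1 / r` times the
dimension of the range of `a`. -/
lemma dimH_range_le_of_dist_le_rpow {ι X Y : Type*} [MetricSpace X] [MetricSpace Y]
    (a : ι → X) (b : ι → Y) {C r : ℝ} (hr : 0 < r)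
    (h : ∀ i j, dist (b i) (b j) ≤ C * dist (a i) (a j) ^ r) :
    dimH (Set.range b) ≤ dimH (Set.range a) / ENNReal.ofReal r := by
  rcases isEmpty_or_nonempty ι with hι | hι
  · simp [Set.range_eq_empty]
  have hab : ∀ i j, a i = a j → b i = b j := by
    intro i j hij
    have := h i j
    rw [hij, dist_self, Real.zero_rpow hr.ne', mul_zero] at this
    exact dist_le_zero.1 this
  let g : X → Y := fun x => b (Function.invFun a x)
  have hg : ∀ i, g (a i) = b i := fun i => hab _ _ (Function.invFun_eq ⟨i, rfl⟩)
  have himg : g '' Set.range a = Set.range b := by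
    rw [← Set.range_comp]
    exact congrArg Set.range (funext hg)
  rw [← himg]
  have hH : HolderOnWith C.toNNReal r.toNNReal g (Set.range a) := by
    rintro _ ⟨i, rfl⟩ _ ⟨j, rfl⟩
    rw [hg, hg, Real.coe_toNNReal r hr.le, edist_dist, edist_dist,
      ENNReal.ofReal_rpow_of_nonneg dist_nonneg hr.le]
    change _ ≤ ENNReal.ofReal C * _
    rw [← ENNReal.ofReal_mul' (by positivity)]
    exact ENNReal.ofReal_le_ofReal (h i j)
  exact hH.dimH_image_le (by simpa using hr)

/-! ### Hyperbolic cosines of comparable distances -/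

/-- Since `exp s / 2 ≤ cosh s ≤ exp s` for `s ≥ 0`, the power `cosh d ^ t` is comparable
to `cosh D` as soon as `D - t d` is bounded. -/
lemma cosh_rpow_comparison {D d t C : ℝ} (hD : 0 ≤ D) (hd : 0 ≤ d) (ht0 : 0 < t) (ht1 : t < 1)
    (h : |D - t * d| ≤ C) :
    Real.cosh D ≤ 2 * Real.exp C * Real.cosh d ^ t ∧
      Real.cosh d ^ t ≤ 2 * Real.exp C * Real.cosh D := by
  have hle : ∀ {s : ℝ}, 0 ≤ s → Real.cosh s ≤ Real.exp s := fun {s} hs => by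
    rw [Real.cosh_eq]; linarith [Real.exp_le_exp.2 (by linarith : -s ≤ s)]
  have hge : ∀ s : ℝ, Real.exp s ≤ 2 * Real.cosh s := fun s => by
    rw [Real.cosh_eq]; linarith [Real.exp_pos (-s)]
  obtain ⟨h1, h2⟩ := abs_le.1 h
  have h2t : (2 : ℝ) ^ t ≤ 2 := by
    simpa using Real.rpow_le_rpow_of_exponent_le (one_le_two) ht1.le
  have hc := (Real.cosh_pos d).le
  have hexp : Real.exp (t * d) = Real.exp d ^ t := by
    rw [← Real.exp_mul, mul_comm]
  constructor
  · calc Real.cosh D ≤ Real.exp (C + t * d) := (hle hD).trans (Real.exp_le_exp.2 (by linarith))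
      _ = Real.exp C * Real.exp d ^ t := by rw [Real.exp_add, hexp]
      _ ≤ Real.exp C * (2 * Real.cosh d) ^ t := by gcongr; exact hge d
      _ = Real.exp C * (2 ^ t * Real.cosh d ^ t) := by rw [Real.mul_rpow zero_le_two hc]
      _ ≤ Real.exp C * (2 * Real.cosh d ^ t) := by gcongr
      _ = _ := by ring
  · calc Real.cosh d ^ t ≤ Real.exp d ^ t := by gcongr; exact hle hd
      _ ≤ Real.exp (C + D) := by rw [← hexp]; exact Real.exp_le_exp.2 (by linarith)
      _ ≤ Real.exp C * (2 * Real.cosh D) := by rw [Real.exp_add]; gcongr; exact hge D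
      _ = _ := by ring

open Filter

/-! ### The Lorentzian form on the compactification -/

section Compactification

variable {H : Type*} [NormedAddCommGroup H] [InnerProductSpace ℝ H]

/-- The base point `(1, 0)` of the hyperboloid. -/
def origin (H : Type*) [NormedAddCommGroup H] [InnerProductSpace ℝ H] : Hyp H where
  vec := (1, 0)
  time_pos := one_pos
  lorentz_self := by simp [lorentz]

lemma cosh_dist (x y : Hyp H) : Real.cosh (dist x y) = lorentz x.vec y.vec :=
  Real.cosh_arcosh (one_le_lorentz x y)

lemma cosh_dist_origin (x : Hyp H) : Real.cosh (dist x (origin H)) = x.vec.1 := by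
  simp [cosh_dist, lorentz, origin]

lemma continuous_lorentz : Continuous fun v : (ℝ × H) × (ℝ × H) => lorentz v.1 v.2 := by
  unfold lorentz; fun_prop

/-- Two moving points of the hyperbolic space whose Lorentzian product tends to `1` become
arbitrarily close. -/
lemma tendsto_hyp_of_tendsto_lorentz {ι : Type*} {l : Filter ι} {x y : ι → Hyp H}
    (h : Tendsto (fun i => lorentz (x i).vec (y i).vec) l (𝓝 1)) :
    Tendsto (fun i => dist (x i) (y i)) l (𝓝 0) := by
  have h1 : Tendsto Real.arcosh (𝓝[Set.Ici 1] 1) (𝓝 0) := by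
    have := Real.continuousOn_arcosh 1 (Set.mem_Ici.2 le_rfl)
    rwa [ContinuousWithinAt, Real.arcosh_zero] at this
  exact h1.comp (tendsto_nhdsWithin_iff.2 ⟨h, .of_forall fun i => one_le_lorentz _ _⟩)

lemma continuous_lorentz_hyp : Continuous fun p : Hyp H × Hyp H => lorentz p.1.vec p.2.vec := by
  simp only [← cosh_dist]
  exact Real.continuous_cosh.comp continuous_dist

lemma continuous_time : Continuous fun x : Hyp H => x.vec.1 := by
  simp only [← cosh_dist_origin]
  exact Real.continuous_cosh.comp (continuous_id.dist continuous_const)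

namespace Compactification

lemma lorentz_eq (a b : Compactification H) :
    lorentz a.vec b.vec = 1 - inner ℝ a.vec.2 b.vec.2 := by
  simp [lorentz, a.time_eq_one, b.time_eq_one]

/-- In the chart `v₀ = 1` the Euclidean distance is expressed by the Lorentzian form. -/
lemma norm_sub_sq (a b : Compactification H) :
    ‖a.vec.2 - b.vec.2‖ ^ 2 =
      2 * lorentz a.vec b.vec - lorentz a.vec a.vec - lorentz b.vec b.vec := by
  simp only [lorentz_eq, norm_sub_sq_real, real_inner_self_eq_norm_sq]
  ring

lemma norm_le_one (a : Compactification H) : ‖a.vec.2‖ ≤ 1 := by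
  have h := a.lorentz_self_nonneg
  rw [lorentz_eq, real_inner_self_eq_norm_sq] at h
  nlinarith [norm_nonneg a.vec.2]

lemma lorentz_nonneg (a b : Compactification H) : 0 ≤ lorentz a.vec b.vec := by
  have := sq_nonneg ‖a.vec.2 - b.vec.2‖
  rw [norm_sub_sq] at this
  linarith [a.lorentz_self_nonneg, b.lorentz_self_nonneg]

lemma continuous_vec : Continuous (vec : Compactification H → ℝ × H) := continuous_induced_dom

lemma tendsto_lorentz {ι : Type*} {l : Filter ι} {x y : ι → Compactification H}
    {a b : Compactification H} (hx : Tendsto x l (𝓝 a)) (hy : Tendsto y l (𝓝 b)) :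
    Tendsto (fun i => lorentz (x i).vec (y i).vec) l (𝓝 (lorentz a.vec b.vec)) :=
  (continuous_lorentz.tendsto (a.vec, b.vec)).comp
    (((continuous_vec.tendsto a).comp hx).prodMk_nhds ((continuous_vec.tendsto b).comp hy))

lemma tendsto_iff {ι : Type*} {l : Filter ι} {a : ι → Compactification H}
    {b : Compactification H} :
    Tendsto a l (𝓝 b) ↔ Tendsto (fun i => (a i).vec.2) l (𝓝 b.vec.2) := by
  rw [nhds_induced, tendsto_comap_iff]
  constructor
  · exact fun h => (continuous_snd.tendsto _).comp h
  · intro h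
    rw [nhds_prod_eq]
    refine Tendsto.prodMk ?_ h |>.congr fun i => rfl
    simp only [time_eq_one]
    exact tendsto_const_nhds

lemma tendsto_of_norm_sub_sq {ι : Type*} {l : Filter ι} {a : ι → Compactification H}
    {b : Compactification H}
    (h : Tendsto (fun i => ‖(a i).vec.2 - b.vec.2‖ ^ 2) l (𝓝 0)) : Tendsto a l (𝓝 b) := by
  rw [tendsto_iff, tendsto_iff_norm_sub_tendsto_zero]
  have := h.sqrt
  simpa [Real.sqrt_sq (norm_nonneg _)] using this

/-- The point of the hyperbolic space on a line where the Lorentzian form is positive. -/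
def toHyp (a : Compactification H) (ha : 0 < lorentz a.vec a.vec) : Hyp H where
  vec := (√(lorentz a.vec a.vec))⁻¹ • a.vec
  time_pos := by simpa [a.time_eq_one] using ha
  lorentz_self := by
    rw [lorentz_smul_left, lorentz_smul_right, ← mul_assoc, ← mul_inv, Real.mul_self_sqrt ha.le,
      inv_mul_cancel₀ ha.ne']

lemma toCompactification_toHyp (a : Compactification H) (ha : 0 < lorentz a.vec a.vec) :
    (a.toHyp ha).toCompactification = a := by
  have h : √(lorentz a.vec a.vec) ≠ 0 := (Real.sqrt_pos.2 ha).ne'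
  apply Compactification.ext
  simp [Hyp.toCompactification, toHyp, a.time_eq_one, smul_smul, h]

/-- A line on which the Lorentzian form vanishes, as a point of the boundary. -/
def toBoundary (a : Compactification H) (ha : lorentz a.vec a.vec = 0) : Boundary H :=
  ⟨a.vec, a.time_eq_one, ha⟩

end Compactification

lemma Hyp.lorentz_toCompactification (x y : Hyp H) :
    lorentz x.toCompactification.vec y.toCompactification.vec =
      lorentz x.vec y.vec / (x.vec.1 * y.vec.1) := by
  have := x.time_pos.ne'
  have := y.time_pos.ne'
  simp only [Hyp.toCompactification, lorentz_smul_left, lorentz_smul_right]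
  field_simp

lemma Hyp.lorentz_toCompactification_self_pos (x : Hyp H) :
    0 < lorentz x.toCompactification.vec x.toCompactification.vec := by
  rw [lorentz_toCompactification, x.lorentz_self]
  have := x.time_pos
  positivity

lemma Hyp.toCompactification_injective :
    Function.Injective (Hyp.toCompactification : Hyp H → Compactification H) := by
  intro x y h
  have hv : x.vec.1⁻¹ • x.vec = y.vec.1⁻¹ • y.vec := congrArg Compactification.vec h
  have hx := x.time_pos
  have hy := y.time_pos
  have h1 : (x.vec.1 ^ 2)⁻¹ = (y.vec.1 ^ 2)⁻¹ := by
    have := congrArg (fun v => lorentz v v) hv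
    simpa [lorentz_smul_left, lorentz_smul_right, x.lorentz_self, y.lorentz_self, sq] using this
  have h2 : x.vec.1 = y.vec.1 := by
    rw [inv_inj] at h1
    exact (pow_left_inj₀ hx.le hy.le two_ne_zero).1 h1
  rw [h2] at hv
  exact Hyp.ext (smul_right_injective _ (inv_ne_zero hy.ne') hv)

lemma Hyp.continuous_toCompactification :
    Continuous (Hyp.toCompactification : Hyp H → Compactification H) := by
  rw [continuous_iff_continuousAt]
  intro y
  apply Compactification.tendsto_of_norm_sub_sq
  simp only [Compactification.norm_sub_sq, Hyp.lorentz_toCompactification, Hyp.lorentz_self]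
  have hy := y.time_pos.ne'
  have h1 : Tendsto (fun x : Hyp H => x.vec.1) (𝓝 y) (𝓝 y.vec.1) := continuous_time.tendsto y
  have h2 : Tendsto (fun x : Hyp H => lorentz x.vec y.vec) (𝓝 y) (𝓝 1) := by
    have := (continuous_lorentz_hyp.comp (continuous_id.prodMk continuous_const)).tendsto
      (x := y) (f := fun x : Hyp H => lorentz x.vec y.vec)
    simpa [y.lorentz_self] using this
  have h3 := (((h2.div (h1.mul_const y.vec.1) (mul_ne_zero hy hy)).const_mul 2).sub
    ((tendsto_const_nhds (x := (1 : ℝ))).div (h1.mul h1) (mul_ne_zero hy hy))).sub_const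
      (1 / (y.vec.1 * y.vec.1))
  convert h3 using 2
  · simp only [Pi.div_apply]
  · ring

/-- Every point of the compactification is a limit of points of the hyperbolic space. -/
lemma exists_seq_tendsto (a : Compactification H) :
    ∃ x : ℕ → Hyp H, Tendsto (fun k => (x k).toCompactification) atTop (𝓝 a) := by
  -- Move along the segment from the centre of the ball to `a`, with ratio `r k < 1`.
  let r : ℕ → ℝ := fun k => 1 - 1 / ((k : ℝ) + 1)
  have hr : ∀ k, 0 ≤ r k ∧ r k < 1 := by
    intro k
    have h0 : (0 : ℝ) < (k : ℝ) + 1 := by positivity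
    have h1 : 1 / ((k : ℝ) + 1) ≤ 1 := by
      rw [div_le_one h0]; linarith [(Nat.cast_nonneg k : (0 : ℝ) ≤ k)]
    have h2 : 0 < 1 / ((k : ℝ) + 1) := by positivity
    exact ⟨by simp only [r]; linarith, by simp only [r]; linarith⟩
  have hpos : ∀ k, 0 < lorentz ((1 : ℝ), r k • a.vec.2) ((1 : ℝ), r k • a.vec.2) := by
    intro k
    have h1 := a.norm_le_one
    have h2 : ‖r k • a.vec.2‖ < 1 := by
      rw [norm_smul, Real.norm_eq_abs, abs_of_nonneg (hr k).1]
      nlinarith [hr k, norm_nonneg a.vec.2]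
    simp only [lorentz, real_inner_self_eq_norm_sq]
    nlinarith [norm_nonneg (r k • a.vec.2)]
  let b : ℕ → Compactification H := fun k => ⟨(1, r k • a.vec.2), rfl, (hpos k).le⟩
  refine ⟨fun k => (b k).toHyp (hpos k), ?_⟩
  simp only [Compactification.toCompactification_toHyp]
  rw [Compactification.tendsto_iff]
  have h : Tendsto r atTop (𝓝 1) := by
    simpa [r] using (tendsto_one_div_add_atTop_nhds_zero_nat (𝕜 := ℝ)).const_sub 1
  simpa using h.smul_const a.vec.2

end Compactification

/-! ### Continuity of orbit maps -/

section OrbitMap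

variable {H : Type*} [NormedAddCommGroup H] [InnerProductSpace ℝ H]

lemma lorentz_add_left (x y z : ℝ × H) : lorentz (x + y) z = lorentz x z + lorentz y z := by
  simp only [lorentz, Prod.fst_add, Prod.snd_add, inner_add_left]; ring

lemma lorentz_add_right (x y z : ℝ × H) : lorentz x (y + z) = lorentz x y + lorentz x z := by
  rw [lorentz_comm, lorentz_add_left, lorentz_comm y, lorentz_comm z]

/-- The image of `z` under the central symmetry of the hyperbolic space at `m`. -/
def centralSymmetryFun (m z : Hyp H) : Hyp H where
  vec := (2 * lorentz z.vec m.vec) • m.vec - z.vec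
  time_pos := by
    -- By the triangle inequality, the time coordinate of `z` is at most
    -- `cosh (d(z, m) + d(m, o))`, which is less than `2 cosh d(z, m) cosh d(m, o)`.
    have h := lorentz_triangle z m (origin H)
    have e : ∀ x : Hyp H, lorentz x.vec (origin H).vec = x.vec.1 := fun x => by
      simp [lorentz, origin]
    rw [e, e] at h
    have h1 := one_le_lorentz z m
    have h2 := m.time_pos
    have h3 : 1 ≤ m.vec.1 := by rw [← e]; exact one_le_lorentz _ _
    have h4 : √(lorentz z.vec m.vec ^ 2 - 1) < lorentz z.vec m.vec := by
      rw [Real.sqrt_lt' (by linarith)]; linarith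
    have h5 : √(m.vec.1 ^ 2 - 1) < m.vec.1 := by
      rw [Real.sqrt_lt' h2]; linarith
    have h6 := mul_lt_mul'' h4 h5 (Real.sqrt_nonneg _) (Real.sqrt_nonneg _)
    simp only [Prod.fst_sub, Prod.smul_fst, smul_eq_mul]
    linarith
  lorentz_self := by
    simp only [lorentz_sub_left, lorentz_sub_right, lorentz_smul_left, lorentz_smul_right,
      m.lorentz_self, z.lorentz_self, lorentz_comm m.vec z.vec]
    ring

/-- The central symmetry of the hyperbolic space at `m`, as an isometry. -/
def centralSymmetry (m : Hyp H) : Hyp H ≃ᵢ Hyp H where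
  toFun := centralSymmetryFun m
  invFun := centralSymmetryFun m
  left_inv z := by
    apply Hyp.ext
    simp only [centralSymmetryFun, lorentz_sub_left, lorentz_smul_left, m.lorentz_self]
    module
  right_inv z := by
    apply Hyp.ext
    simp only [centralSymmetryFun, lorentz_sub_left, lorentz_smul_left, m.lorentz_self]
    module
  isometry_toFun := by
    refine Isometry.of_dist_eq fun z w => ?_
    change Real.arcosh _ = Real.arcosh _
    congr 1
    simp only [centralSymmetryFun, lorentz_sub_left, lorentz_sub_right, lorentz_smul_left,
      lorentz_smul_right, m.lorentz_self, lorentz_comm m.vec w.vec]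
    ring

lemma centralSymmetry_vec (m z : Hyp H) :
    (centralSymmetry m z).vec = (2 * lorentz z.vec m.vec) • m.vec - z.vec := rfl

lemma continuous_centralSymmetry :
    Continuous[inferInstance, isometryTopology (Hyp H)] (centralSymmetry (H := H)) := by
  rw [continuous_induced_rng, continuous_pi_iff]
  intro z
  rw [continuous_iff_continuousAt]
  intro m
  rw [ContinuousAt, tendsto_iff_dist_tendsto_zero]
  apply tendsto_hyp_of_tendsto_lorentz
  have h1 : Tendsto (fun m' : Hyp H => lorentz z.vec m'.vec) (𝓝 m) (𝓝 (lorentz z.vec m.vec)) :=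
    (continuous_lorentz_hyp.comp (continuous_const.prodMk continuous_id)).tendsto m
  have h2 : Tendsto (fun m' : Hyp H => lorentz m'.vec m.vec) (𝓝 m) (𝓝 (lorentz m.vec m.vec)) :=
    (continuous_lorentz_hyp.comp (continuous_id.prodMk continuous_const)).tendsto m
  rw [m.lorentz_self] at h2
  have h3 := ((((h1.mul h2).mul_const (4 * lorentz z.vec m.vec)).sub
    ((h1.mul h1).const_mul 2)).sub_const (2 * lorentz z.vec m.vec ^ 2)).add_const 1
  convert h3 using 2
  · simp only [Function.comp, centralSymmetry_vec, lorentz_sub_left, lorentz_sub_right,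
      lorentz_smul_left, lorentz_smul_right, z.lorentz_self, lorentz_comm _ z.vec]
    ring
  · ring

/-- The midpoint of the geodesic segment between `x` and `y`. -/
def midpoint (x y : Hyp H) : Hyp H where
  vec := (√(2 * (1 + lorentz x.vec y.vec)))⁻¹ • (x.vec + y.vec)
  time_pos := by
    have := one_le_lorentz x y
    have hx := x.time_pos
    have hy := y.time_pos
    simp only [Prod.smul_fst, Prod.fst_add, smul_eq_mul]
    positivity
  lorentz_self := by
    have := one_le_lorentz x y
    have h : 0 < 2 * (1 + lorentz x.vec y.vec) := by linarith
    rw [lorentz_smul_left, lorentz_smul_right, ← mul_assoc, ← mul_inv, Real.mul_self_sqrt h.le,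
      inv_mul_eq_one₀ h.ne']
    simp only [lorentz_add_left, lorentz_add_right, x.lorentz_self, y.lorentz_self,
      lorentz_comm y.vec x.vec]
    ring

lemma lorentz_midpoint (x y : Hyp H) :
    lorentz x.vec (midpoint x y).vec =
      (√(2 * (1 + lorentz x.vec y.vec)))⁻¹ * (1 + lorentz x.vec y.vec) := by
  simp only [midpoint, lorentz_smul_right, lorentz_add_right, x.lorentz_self]

lemma centralSymmetry_midpoint (x y : Hyp H) : centralSymmetry (midpoint x y) x = y := by
  apply Hyp.ext
  have := one_le_lorentz x y
  have h : 0 < 2 * (1 + lorentz x.vec y.vec) := by linarith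
  rw [centralSymmetry_vec, lorentz_midpoint]
  have h2 : 2 * ((√(2 * (1 + lorentz x.vec y.vec)))⁻¹ * (1 + lorentz x.vec y.vec)) *
      (√(2 * (1 + lorentz x.vec y.vec)))⁻¹ = 1 := by
    have : ∀ s : ℝ, 2 * (s⁻¹ * (1 + lorentz x.vec y.vec)) * s⁻¹ =
      (s * s)⁻¹ * (2 * (1 + lorentz x.vec y.vec)) := fun s => by rw [mul_inv]; ring
    rw [this, Real.mul_self_sqrt h.le, inv_mul_cancel₀ h.ne']
  simp only [midpoint, smul_smul, h2, one_smul, add_sub_cancel_left]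

lemma midpoint_self (x : Hyp H) : midpoint x x = x := by
  apply Hyp.ext
  have : √(2 * (1 + 1) : ℝ) = 2 := by
    rw [Real.sqrt_eq_iff_mul_self_eq] <;> norm_num
  simp only [midpoint, x.lorentz_self, this]
  module

lemma tendsto_midpoint (x : Hyp H) : Tendsto (midpoint x) (𝓝 x) (𝓝 x) := by
  rw [tendsto_iff_dist_tendsto_zero]
  simp only [dist_comm _ x]
  apply tendsto_hyp_of_tendsto_lorentz (x := fun _ => x)
  simp only [lorentz_midpoint]
  have h1 : Tendsto (fun y : Hyp H => 1 + lorentz x.vec y.vec) (𝓝 x) (𝓝 2) := by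
    have := ((continuous_lorentz_hyp.comp (continuous_const.prodMk continuous_id)).tendsto
      (x := x) (f := fun y : Hyp H => lorentz x.vec y.vec)).const_add 1
    rw [x.lorentz_self] at this
    convert this using 2
    norm_num
  have h2 := ((h1.const_mul 2).sqrt.inv₀ (by positivity)).mul h1
  have h4 : √(2 * 2 : ℝ) = 2 := Real.sqrt_mul_self zero_le_two
  rw [h4] at h2
  simpa using h2

/-- Orbit maps of a continuous representation are continuous: a point `y` near `x` is the image of
`x` under the central symmetry at the midpoint, which is close to the central symmetry at `x`. -/
lemma IsOrbitMap.continuous {K : Type*} [NormedAddCommGroup K] [InnerProductSpace ℝ K]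
    {ρ : (Hyp K ≃ᵢ Hyp K) →* (Hyp H ≃ᵢ Hyp H)} {f : Hyp K → Hyp H} (hf : IsOrbitMap ρ f)
    (hρ : ∀ y : Hyp H, Continuous[isometryTopology (Hyp K), inferInstance] fun g => ρ g y) :
    Continuous f := by
  rw [continuous_iff_continuousAt]
  intro x
  let _ := isometryTopology (Hyp K)
  have h1 : Continuous fun m : Hyp K => ρ (centralSymmetry m) (f x) :=
    (hρ (f x)).comp continuous_centralSymmetry
  have h2 := (h1.tendsto x).comp (tendsto_midpoint x)
  have h3 : ∀ y, ρ (centralSymmetry (midpoint x y)) (f x) = f y := fun y => by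
    rw [← hf, centralSymmetry_midpoint]
  have h4 : ρ (centralSymmetry x) (f x) = f x := by
    have := h3 x
    rwa [midpoint_self] at this
  rw [h4] at h2
  exact h2.congr h3

end OrbitMap

/-! ### Extension to the boundary -/

section Extension

variable {K : Type*} [NormedAddCommGroup K] [InnerProductSpace ℝ K]
  {H : Type*} [NormedAddCommGroup H] [InnerProductSpace ℝ H]

/-- A map which multiplies distances by `t` up to an additive error raises the Lorentzian form, in
the chart `v₀ = 1`, to the power `t` up to a multiplicative constant. -/
lemma exists_lorentz_comparison {f : Hyp K → Hyp H} {t C : ℝ} (ht0 : 0 < t) (ht1 : t < 1)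
    (hft : ∀ x y, |dist (f x) (f y) - t * dist x y| ≤ C) :
    ∃ A : ℝ, 0 < A ∧ ∀ x y : Hyp K,
      lorentz (f x).toCompactification.vec (f y).toCompactification.vec ≤
          A * lorentz x.toCompactification.vec y.toCompactification.vec ^ t ∧
        lorentz x.toCompactification.vec y.toCompactification.vec ^ t ≤
          A * lorentz (f x).toCompactification.vec (f y).toCompactification.vec := by
  set C' := C + dist (f (origin K)) (origin H) with hC'
  set a := 2 * Real.exp C' with ha
  have ha0 : 0 < a := by positivity
  have hxy : ∀ x y, lorentz (f x).vec (f y).vec ≤ a * lorentz x.vec y.vec ^ t ∧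
      lorentz x.vec y.vec ^ t ≤ a * lorentz (f x).vec (f y).vec := by
    intro x y
    rw [← cosh_dist, ← cosh_dist]
    exact cosh_rpow_comparison dist_nonneg dist_nonneg ht0 ht1
      ((hft x y).trans (le_add_of_nonneg_right dist_nonneg))
  -- The time coordinate is the hyperbolic cosine of the distance to the origin.
  have hx : ∀ x, (f x).vec.1 ≤ a * x.vec.1 ^ t ∧ x.vec.1 ^ t ≤ a * (f x).vec.1 := by
    intro x
    rw [← cosh_dist_origin, ← cosh_dist_origin]
    refine cosh_rpow_comparison dist_nonneg dist_nonneg ht0 ht1 ?_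
    obtain ⟨h1, h2⟩ := abs_le.1 (hft x (origin K))
    have h3 := dist_triangle (f x) (f (origin K)) (origin H)
    have h4 := dist_triangle (f x) (origin H) (f (origin K))
    rw [dist_comm (origin H)] at h4
    rw [abs_le]
    constructor <;> linarith
  refine ⟨a ^ 3, by positivity, fun x y => ?_⟩
  have hX := x.time_pos
  have hY := y.time_pos
  have hX' := (f x).time_pos
  have hY' := (f y).time_pos
  have hB := one_le_lorentz x y
  have hB' := one_le_lorentz (f x) (f y)
  rw [Hyp.lorentz_toCompactification, Hyp.lorentz_toCompactification,
    Real.div_rpow (by linarith) (by positivity), Real.mul_rpow hX.le hY.le, ← mul_div_assoc,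
    ← mul_div_assoc, div_le_div_iff₀ (by positivity) (by positivity),
    div_le_div_iff₀ (by positivity) (by positivity)]
  constructor
  · calc lorentz (f x).vec (f y).vec * (x.vec.1 ^ t * y.vec.1 ^ t)
        ≤ (a * lorentz x.vec y.vec ^ t) * ((a * (f x).vec.1) * (a * (f y).vec.1)) := by
          gcongr
          exacts [(hxy x y).1, (hx x).2, (hx y).2]
      _ = _ := by ring
  · calc lorentz x.vec y.vec ^ t * ((f x).vec.1 * (f y).vec.1)
        ≤ (a * lorentz (f x).vec (f y).vec) * ((a * x.vec.1 ^ t) * (a * y.vec.1 ^ t)) := by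
          gcongr
          exacts [(hxy x y).2, (hx x).1, (hx y).1]
      _ = _ := by ring

/-- If the Lorentzian form is raised to the power `t`, then sequences converging to the boundary
are sent to Cauchy sequences, so that limits define an extension to the boundary. The comparison of
the Lorentzian forms passes to the limit. -/
lemma exists_continuous_extension [CompleteSpace H] {f : Hyp K → Hyp H} (hf : Continuous f)
    {t A : ℝ} (ht : 0 < t)
    (h : ∀ x y : Hyp K,
      lorentz (f x).toCompactification.vec (f y).toCompactification.vec ≤
          A * lorentz x.toCompactification.vec y.toCompactification.vec ^ t ∧
        lorentz x.toCompactification.vec y.toCompactification.vec ^ t ≤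
          A * lorentz (f x).toCompactification.vec (f y).toCompactification.vec) :
    ∃ F : Compactification K → Compactification H, Continuous F ∧
      (∀ x : Hyp K, F x.toCompactification = (f x).toCompactification) ∧
      ∀ a b, lorentz (F a).vec (F b).vec ≤ A * lorentz a.vec b.vec ^ t ∧
        lorentz a.vec b.vec ^ t ≤ A * lorentz (F a).vec (F b).vec := by
  have hboundary : ∀ a : Compactification K, lorentz a.vec a.vec = 0 →
      ∀ x : ℕ → Hyp K, Tendsto (fun k => (x k).toCompactification) atTop (𝓝 a) →
      ∃ b : Compactification H, Tendsto (fun k => (f (x k)).toCompactification) atTop (𝓝 b) := by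
    intro a ha x hx
    have hc : CauchySeq fun k => (f (x k)).toCompactification.vec.2 := by
      rw [cauchySeq_iff_tendsto_dist_atTop_0]
      have h1 : Tendsto (fun n : ℕ × ℕ => lorentz (x n.1).toCompactification.vec
          (x n.2).toCompactification.vec) atTop (𝓝 0) := by
        rw [← ha]
        apply Compactification.tendsto_lorentz
        · exact hx.comp (by rw [← prod_atTop_atTop_eq]; exact tendsto_fst)
        · exact hx.comp (by rw [← prod_atTop_atTop_eq]; exact tendsto_snd)
      have h2 := ((h1.rpow_const (p := t) (Or.inr ht.le)).const_mul (2 * A)).sqrt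
      rw [Real.zero_rpow ht.ne', mul_zero, Real.sqrt_zero] at h2
      refine squeeze_zero (fun _ => dist_nonneg) (fun n => ?_) h2
      rw [dist_eq_norm]
      apply Real.le_sqrt_of_sq_le
      rw [Compactification.norm_sub_sq]
      have := (h (x n.1) (x n.2)).1
      have := (f (x n.1)).toCompactification.lorentz_self_nonneg
      have := (f (x n.2)).toCompactification.lorentz_self_nonneg
      linarith
    obtain ⟨v, hv⟩ := cauchySeq_tendsto_of_complete hc
    have hv1 : ‖v‖ ≤ 1 := le_of_tendsto hv.norm
      (.of_forall fun k => (f (x k)).toCompactification.norm_le_one)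
    refine ⟨⟨(1, v), rfl, ?_⟩, Compactification.tendsto_iff.2 hv⟩
    simp only [lorentz, real_inner_self_eq_norm_sq]
    nlinarith [norm_nonneg v]
  have hex : ∀ a : Compactification K, ∃ (b : Compactification H) (x : ℕ → Hyp K),
      Tendsto (fun k => (x k).toCompactification) atTop (𝓝 a) ∧
      Tendsto (fun k => (f (x k)).toCompactification) atTop (𝓝 b) ∧
      ∀ y : Hyp K, a = y.toCompactification → b = (f y).toCompactification := by
    intro a
    rcases a.lorentz_self_nonneg.eq_or_lt with ha | ha
    · obtain ⟨x, hx⟩ := exists_seq_tendsto a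
      obtain ⟨b, hb⟩ := hboundary a ha.symm x hx
      refine ⟨b, x, hx, hb, fun y hy => ?_⟩
      have := y.lorentz_toCompactification_self_pos
      rw [← hy] at this
      linarith
    · refine ⟨(f (a.toHyp ha)).toCompactification, fun _ => a.toHyp ha, ?_, tendsto_const_nhds,
        fun y hy => ?_⟩
      · simp only [a.toCompactification_toHyp ha]
        exact tendsto_const_nhds
      · rw [← a.toCompactification_toHyp ha] at hy
        rw [Hyp.toCompactification_injective hy]
  choose F x hx hFx hF using hex
  have hcomp : ∀ a b, lorentz (F a).vec (F b).vec ≤ A * lorentz a.vec b.vec ^ t ∧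
      lorentz a.vec b.vec ^ t ≤ A * lorentz (F a).vec (F b).vec := by
    intro a b
    have h1 := (Compactification.tendsto_lorentz (hx a) (hx b)).rpow_const (p := t) (Or.inr ht.le)
    have h2 := Compactification.tendsto_lorentz (hFx a) (hFx b)
    exact ⟨le_of_tendsto_of_tendsto' h2 (h1.const_mul A) fun k => (h _ _).1,
      le_of_tendsto_of_tendsto' h1 (h2.const_mul A) fun k => (h _ _).2⟩
  refine ⟨F, ?_, fun x => hF _ x rfl, hcomp⟩
  rw [continuous_iff_continuousAt]
  intro a
  have hself : Continuous fun b : Compactification K => lorentz b.vec b.vec :=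
    continuous_lorentz.comp
      (Compactification.continuous_vec.prodMk Compactification.continuous_vec)
  have hright : Continuous fun b : Compactification K => lorentz b.vec a.vec :=
    continuous_lorentz.comp (Compactification.continuous_vec.prodMk continuous_const)
  rcases a.lorentz_self_nonneg.eq_or_lt with ha | ha
  · -- At a boundary point the comparison alone gives continuity.
    apply Compactification.tendsto_of_norm_sub_sq
    have h1 := ((hright.tendsto a).rpow_const (p := t) (Or.inr ht.le)).const_mul (2 * A)
    rw [← ha, Real.zero_rpow ht.ne', mul_zero] at h1
    refine squeeze_zero (fun _ => sq_nonneg _) (fun b => ?_) h1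
    rw [Compactification.norm_sub_sq]
    have := (hcomp b a).1
    have := (F b).lorentz_self_nonneg
    have := (F a).lorentz_self_nonneg
    linarith
  · -- Near an interior point, `F` is `f` in the hyperboloid model.
    obtain ⟨z, rfl⟩ : ∃ z : Hyp K, z.toCompactification = a :=
      ⟨a.toHyp ha, a.toCompactification_toHyp ha⟩
    have hev : ∀ᶠ b in 𝓝 z.toCompactification, 0 < lorentz b.vec b.vec :=
      hself.continuousAt.eventually (lt_mem_nhds ha)
    let r : Compactification K → Hyp K := fun b =>
      if hb : 0 < lorentz b.vec b.vec then b.toHyp hb else z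
    have hr : ∀ b, 0 < lorentz b.vec b.vec → (r b).toCompactification = b := fun b hb => by
      simp only [r, dif_pos hb, b.toCompactification_toHyp hb]
    have hrz : Tendsto r (𝓝 z.toCompactification) (𝓝 z) := by
      rw [tendsto_iff_dist_tendsto_zero]
      apply tendsto_hyp_of_tendsto_lorentz (y := fun _ => z)
      have hs : √(lorentz z.toCompactification.vec z.toCompactification.vec) ≠ 0 :=
        (Real.sqrt_pos.2 ha).ne'
      have h1 := ((hself.tendsto z.toCompactification).sqrt.inv₀ hs).mul
        ((hright.tendsto z.toCompactification).mul_const z.vec.1)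
      have hz := z.time_pos
      have hlz : ∀ v : ℝ × K, lorentz v z.toCompactification.vec * z.vec.1 = lorentz v z.vec := by
        intro v
        simp only [Hyp.toCompactification, lorentz_smul_right]
        field_simp
      simp only [hlz] at h1
      have h2 : (√(lorentz z.toCompactification.vec z.toCompactification.vec))⁻¹ *
          lorentz z.toCompactification.vec z.vec = 1 := by
        rw [Hyp.lorentz_toCompactification, z.lorentz_self, one_div, Real.sqrt_inv,
          Real.sqrt_mul_self hz.le, inv_inv]
        simp only [Hyp.toCompactification, lorentz_smul_left, z.lorentz_self]
        field_simp
      rw [h2] at h1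
      refine h1.congr' ?_
      filter_upwards [hev] with b hb
      simp only [r, dif_pos hb, Compactification.toHyp, lorentz_smul_left]
    rw [ContinuousAt, hF _ z rfl]
    have h3 := (Hyp.continuous_toCompactification.tendsto (f z)).comp ((hf.tendsto z).comp hrz)
    refine h3.congr' ?_
    filter_upwards [hev] with b hb
    exact (hF b (r b) (hr b hb).symm).symm

end Extension

/-! ### The boundary map and the visual distances -/

section Boundary

variable {K : Type*} [NormedAddCommGroup K] [InnerProductSpace ℝ K]
  {H : Type*} [NormedAddCommGroup H] [InnerProductSpace ℝ H]

namespace Boundary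

lemma lorentz_nonneg (ξ η : Boundary H) : 0 ≤ lorentz ξ.vec η.vec :=
  ξ.toCompactification.lorentz_nonneg η.toCompactification

lemma lorentz_eq_norm_sub_sq (ξ η : Boundary H) :
    lorentz ξ.vec η.vec = ‖ξ.vec.2 - η.vec.2‖ ^ 2 / 2 := by
  have := ξ.toCompactification.norm_sub_sq η.toCompactification
  simp only [toCompactification, ξ.lorentz_self, η.lorentz_self] at this
  linarith

lemma norm_eq_one (ξ : Boundary H) : ‖ξ.vec.2‖ = 1 := by
  have h := ξ.lorentz_self
  simp only [lorentz, ξ.time_eq_one, real_inner_self_eq_norm_sq] at h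
  nlinarith [norm_nonneg ξ.vec.2]

lemma range_vec_snd : Set.range (fun ξ : Boundary H => ξ.vec.2) = Metric.sphere 0 1 := by
  ext v
  rw [mem_sphere_zero_iff_norm]
  constructor
  · rintro ⟨ξ, rfl⟩
    exact ξ.norm_eq_one
  · intro hv
    exact ⟨⟨(1, v), rfl, by simp [lorentz, hv]⟩, rfl⟩

lemma isInducing_toCompactification :
    IsInducing (toCompactification : Boundary H → Compactification H) :=
  ⟨by
    change TopologicalSpace.induced _ _ =
      TopologicalSpace.induced _ (TopologicalSpace.induced _ _)
    rw [induced_compose]; rfl⟩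

lemma isInducing_vec : IsInducing (vec : Boundary H → ℝ × H) := ⟨rfl⟩

lemma tendsto_iff {ι : Type*} {l : Filter ι} {ξ : ι → Boundary H} {η : Boundary H} :
    Tendsto ξ l (𝓝 η) ↔ Tendsto (fun i => lorentz (ξ i).vec η.vec) l (𝓝 0) := by
  constructor
  · intro h
    have := (continuous_lorentz.comp
      (isInducing_vec.continuous.prodMk (continuous_const (y := η.vec)))).tendsto η |>.comp h
    simpa [Function.comp_def, η.lorentz_self] using this
  · intro h
    rw [isInducing_toCompactification.tendsto_nhds_iff]
    apply Compactification.tendsto_of_norm_sub_sq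
    have h2 := h.const_mul 2
    rw [mul_zero] at h2
    refine h2.congr fun i => ?_
    rw [lorentz_eq_norm_sub_sq]
    simp only [toCompactification, Function.comp]
    ring

end Boundary

/-- A boundary map raising the Lorentzian form to the power `t`, up to constants, is a topological
embedding. -/
lemma isEmbedding_of_lorentz_comparison {φ : Boundary K → Boundary H} {t A : ℝ} (ht : 0 < t)
    (h : ∀ ξ η, lorentz (φ ξ).vec (φ η).vec ≤ A * lorentz ξ.vec η.vec ^ t ∧
      lorentz ξ.vec η.vec ^ t ≤ A * lorentz (φ ξ).vec (φ η).vec) : IsEmbedding φ := by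
  have hrec : ∀ ξ η : Boundary K,
      lorentz ξ.vec η.vec = (lorentz ξ.vec η.vec ^ t) ^ t⁻¹ := fun ξ η =>
    (Real.rpow_rpow_inv (ξ.lorentz_nonneg η) ht.ne').symm
  have htinv : t⁻¹ ≠ 0 := inv_ne_zero ht.ne'
  refine ⟨isInducing_iff_nhds.2 fun η => le_antisymm ?_ ?_, fun ξ η hξη => ?_⟩
  · rw [← tendsto_iff_comap, Boundary.tendsto_iff]
    have h1 := ((Boundary.tendsto_iff.1 (tendsto_id (x := 𝓝 η))).rpow_const
      (p := t) (Or.inr ht.le)).const_mul A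
    rw [Real.zero_rpow ht.ne', mul_zero] at h1
    exact squeeze_zero (fun ξ => (φ ξ).lorentz_nonneg _) (fun ξ => (h ξ η).1) h1
  · change Tendsto id (comap φ (𝓝 (φ η))) (𝓝 η)
    rw [Boundary.tendsto_iff]
    have h1 := (Boundary.tendsto_iff.1 (tendsto_comap (f := φ) (x := 𝓝 (φ η)))).const_mul A
    rw [mul_zero] at h1
    have h2 := (squeeze_zero (fun ξ : Boundary K => Real.rpow_nonneg (ξ.lorentz_nonneg η) t)
      (fun ξ => (h ξ η).2) h1).rpow_const (p := t⁻¹) (Or.inr (inv_nonneg.2 ht.le))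
    rw [Real.zero_rpow htinv] at h2
    exact h2.congr fun ξ => (hrec ξ η).symm
  · have h1 := (h ξ η).2
    rw [hξη, (φ η).lorentz_self, mul_zero] at h1
    have h2 : lorentz ξ.vec η.vec = 0 := by
      rw [hrec, le_antisymm h1 (Real.rpow_nonneg (ξ.lorentz_nonneg η) t), Real.zero_rpow htinv]
    rw [Boundary.lorentz_eq_norm_sub_sq] at h2
    have h3 : ‖ξ.vec.2 - η.vec.2‖ = 0 := by
      rw [← sq_eq_zero_iff]; linarith
    exact Boundary.ext (Prod.ext (ξ.time_eq_one.trans η.time_eq_one.symm)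
      (sub_eq_zero.1 (norm_eq_zero.1 h3)))

/-- The visual distance in terms of the Lorentzian form. -/
lemma visualDist_sq (p : Hyp H) (ξ η : Boundary H) :
    visualDist p ξ η ^ 2 =
      lorentz ξ.vec η.vec / (2 * (lorentz ξ.vec p.vec * lorentz η.vec p.vec)) := by
  have hξ := (lorentz_boundary_pos p ξ).ne'
  have hη := (lorentz_boundary_pos p η).ne'
  have hw : lorentz (direction p ξ - direction p η) p.vec = 0 := by
    simp [lorentz_sub_left, lorentz_direction_base]
  have hnp := (lorentz_self_nonpos p hw).1
  rw [visualDist_eq, div_pow, Real.sq_sqrt (by linarith)]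
  have h1 : direction p ξ - direction p η = (lorentz ξ.vec p.vec)⁻¹ • ξ.vec -
      (lorentz η.vec p.vec)⁻¹ • η.vec := by
    simp only [direction]; abel
  rw [h1]
  simp only [lorentz_sub_left, lorentz_sub_right, lorentz_smul_left, lorentz_smul_right,
    ξ.lorentz_self, η.lorentz_self, lorentz_comm η.vec ξ.vec]
  field_simp
  ring

/-- All visual distances are comparable to the square root of the Lorentzian form. -/
lemma exists_visualDist_comparison (p : Hyp H) :
    ∃ M : ℝ, 0 < M ∧ ∀ ξ η : Boundary H,
      visualDist p ξ η ^ 2 ≤ M * lorentz ξ.vec η.vec ∧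
        lorentz ξ.vec η.vec ≤ M * visualDist p ξ η ^ 2 := by
  have hp := p.norm_sq
  have hp0 := p.time_pos
  have hn := norm_nonneg p.vec.2
  have hlt : ‖p.vec.2‖ < p.vec.1 := lt_of_pow_lt_pow_left₀ 2 hp0.le (by linarith)
  set m := p.vec.1 - ‖p.vec.2‖
  set N := p.vec.1 + ‖p.vec.2‖
  have hm : 0 < m := sub_pos.2 hlt
  have hN : 0 < N := by positivity
  have hb : ∀ ξ : Boundary H, m ≤ lorentz ξ.vec p.vec ∧ lorentz ξ.vec p.vec ≤ N := by
    intro ξ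
    have h := abs_real_inner_le_norm ξ.vec.2 p.vec.2
    rw [ξ.norm_eq_one, one_mul, abs_le] at h
    simp only [lorentz, ξ.time_eq_one, one_mul, m, N]
    constructor <;> linarith
  refine ⟨(2 * (m * m))⁻¹ + 2 * (N * N), by positivity, fun ξ η => ?_⟩
  have hL := ξ.lorentz_nonneg η
  have hξ := lorentz_boundary_pos p ξ
  have hη := lorentz_boundary_pos p η
  constructor
  · rw [visualDist_sq, div_eq_inv_mul]
    gcongr
    have : (2 * (lorentz ξ.vec p.vec * lorentz η.vec p.vec))⁻¹ ≤ (2 * (m * m))⁻¹ := by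
      gcongr
      exacts [(hb ξ).1, (hb η).1]
    have : 0 ≤ 2 * (N * N) := by positivity
    linarith
  · have h1 : lorentz ξ.vec η.vec =
        2 * (lorentz ξ.vec p.vec * lorentz η.vec p.vec) * visualDist p ξ η ^ 2 := by
      rw [visualDist_sq]; field_simp
    rw [h1]
    gcongr
    have : 2 * (lorentz ξ.vec p.vec * lorentz η.vec p.vec) ≤ 2 * (N * N) := by
      gcongr
      exacts [(hb ξ).2, (hb η).2]
    have : 0 ≤ (2 * (m * m))⁻¹ := by positivity
    linarith

lemma visualDist_nonneg (p : Hyp H) (ξ η : Boundary H) : 0 ≤ visualDist p ξ η := by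
  rw [visualDist_eq]; positivity

/-- A boundary map raising the Lorentzian form to the power `t`, up to constants, is Hölder of
exponent `t` for the visual distances, with an inverse which is Hölder of exponent `1 / t`. -/
lemma visualHausdorffDim_range {φ : Boundary K → Boundary H} {t A : ℝ} (ht : 0 < t) (hA : 0 < A)
    (h : ∀ ξ η, lorentz (φ ξ).vec (φ η).vec ≤ A * lorentz ξ.vec η.vec ^ t ∧
      lorentz ξ.vec η.vec ^ t ≤ A * lorentz (φ ξ).vec (φ η).vec) (p : Hyp H) :
    visualHausdorffDim p (Set.range φ) =
      dimH (Metric.sphere (0 : K) 1) / ENNReal.ofReal t := by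
  obtain ⟨M, hM, hMp⟩ := exists_visualDist_comparison p
  have ht' : 0 < t⁻¹ := inv_pos.2 ht
  rw [← Boundary.range_vec_snd]
  let _ := visualMetric p
  apply le_antisymm
  · refine dimH_range_le_of_dist_le_rpow (C := √(M * A)) (fun ξ : Boundary K => ξ.vec.2) φ ht
      fun ξ η => ?_
    change visualDist p (φ ξ) (φ η) ≤ _
    rw [dist_eq_norm]
    refine le_of_abs_le (abs_le_of_sq_le_sq ?_ (by positivity))
    rw [mul_pow, Real.sq_sqrt (by positivity), ← Real.rpow_mul_natCast (norm_nonneg _), mul_comm t,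
      Real.rpow_natCast_mul (norm_nonneg _)]
    calc visualDist p (φ ξ) (φ η) ^ 2 ≤ M * (A * lorentz ξ.vec η.vec ^ t) :=
          (hMp _ _).1.trans (by gcongr; exact (h ξ η).1)
      _ ≤ M * (A * (‖ξ.vec.2 - η.vec.2‖ ^ 2) ^ t) := by
          rw [Boundary.lorentz_eq_norm_sub_sq]
          gcongr
          linarith [sq_nonneg ‖ξ.vec.2 - η.vec.2‖]
      _ = _ := by ring
  · have key := dimH_range_le_of_dist_le_rpow (C := √(2 * (A * M) ^ t⁻¹)) φ
      (fun ξ : Boundary K => ξ.vec.2) ht' fun ξ η => by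
        change _ ≤ _ * visualDist p (φ ξ) (φ η) ^ t⁻¹
        have hD := visualDist_nonneg p (φ ξ) (φ η)
        rw [dist_eq_norm]
        refine le_of_abs_le (abs_le_of_sq_le_sq ?_ (by positivity))
        rw [mul_pow, Real.sq_sqrt (by positivity), ← Real.rpow_mul_natCast hD, mul_comm t⁻¹,
          Real.rpow_natCast_mul hD]
        have hL := ξ.lorentz_nonneg η
        calc ‖ξ.vec.2 - η.vec.2‖ ^ 2 = 2 * (lorentz ξ.vec η.vec ^ t) ^ t⁻¹ := by
              rw [Real.rpow_rpow_inv hL ht.ne', Boundary.lorentz_eq_norm_sub_sq]; ring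
          _ ≤ 2 * (A * (M * visualDist p (φ ξ) (φ η) ^ 2)) ^ t⁻¹ := by
              gcongr
              exact (h ξ η).2.trans (by gcongr; exact (hMp _ _).2)
          _ = _ := by
              rw [← mul_assoc A, Real.mul_rpow (by positivity) (by positivity)]; ring
    rw [ENNReal.ofReal_inv_of_pos ht, div_eq_mul_inv, inv_inv] at key
    rw [ENNReal.div_le_iff (by simpa using ht) ENNReal.ofReal_ne_top]
    exact key

end Boundary

end Hyperbolic

end

theorem mainTheorem4 (n : ℕ) (hn : 2 ≤ n) (t : ℝ) (ht0 : 0 < t) (ht1 : t < 1)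
    {H : Type*} [NormedAddCommGroup H] [InnerProductSpace ℝ H] [CompleteSpace H]
    [TopologicalSpace.SeparableSpace H] (hH : ¬ FiniteDimensional ℝ H)
    (ρ : (Hyperbolic.Hyp (EuclideanSpace ℝ (Fin n)) ≃ᵢ Hyperbolic.Hyp (EuclideanSpace ℝ (Fin n))) →*
      (Hyperbolic.Hyp H ≃ᵢ Hyperbolic.Hyp H))
    (hρ : Hyperbolic.IsExotic ρ)
    (f : Hyperbolic.Hyp (EuclideanSpace ℝ (Fin n)) → Hyperbolic.Hyp H)
    (hf : Hyperbolic.IsOrbitMap ρ f)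
    (hft : ∃ C : ℝ, ∀ x y, |dist (f x) (f y) - t * dist x y| ≤ C) :
    ∃ (F : Hyperbolic.Compactification (EuclideanSpace ℝ (Fin n)) → Hyperbolic.Compactification H)
      (φ : Hyperbolic.Boundary (EuclideanSpace ℝ (Fin n)) → Hyperbolic.Boundary H),
      Continuous F ∧
      (∀ x : Hyperbolic.Hyp (EuclideanSpace ℝ (Fin n)),
        F x.toCompactification = (f x).toCompactification) ∧
      (∀ ξ : Hyperbolic.Boundary (EuclideanSpace ℝ (Fin n)),
        F ξ.toCompactification = (φ ξ).toCompactification) ∧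
      IsEmbedding φ ∧
      ∀ p : Hyperbolic.Hyp H,
        Hyperbolic.visualHausdorffDim p (Set.range φ) = ENNReal.ofReal (((n : ℝ) - 1) / t) := by
  obtain ⟨C, hC⟩ := hft
  obtain ⟨A, hA, hcomp⟩ := Hyperbolic.exists_lorentz_comparison ht0 ht1 hC
  obtain ⟨F, hF, hFf, hFcomp⟩ :=
    Hyperbolic.exists_continuous_extension (hf.continuous hρ.continuous_orbit) ht0 hcomp
  have hbd : ∀ ξ : Hyperbolic.Boundary (EuclideanSpace ℝ (Fin n)),
      Hyperbolic.lorentz (F ξ.toCompactification).vec (F ξ.toCompactification).vec = 0 := by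
    intro ξ
    have h1 := (hFcomp ξ.toCompactification ξ.toCompactification).1
    have h2 : Hyperbolic.lorentz ξ.toCompactification.vec ξ.toCompactification.vec = 0 :=
      ξ.lorentz_self
    rw [h2, Real.zero_rpow ht0.ne', mul_zero] at h1
    exact le_antisymm h1 (F _).lorentz_self_nonneg
  have hφ := fun ξ η : Hyperbolic.Boundary (EuclideanSpace ℝ (Fin n)) =>
    hFcomp ξ.toCompactification η.toCompactification
  refine ⟨F, fun ξ => (F ξ.toCompactification).toBoundary (hbd ξ), hF, hFf, fun ξ => rfl,
    Hyperbolic.isEmbedding_of_lorentz_comparison ht0 hφ, fun p => ?_⟩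
  have hdim : Module.finrank ℝ (EuclideanSpace ℝ (Fin n)) = (n - 1) + 1 := by
    rw [finrank_euclideanSpace_fin]; omega
  have hcast : ((n - 1 : ℕ) : ENNReal) = ENNReal.ofReal ((n : ℝ) - 1) := by
    rw [← ENNReal.ofReal_natCast, Nat.cast_sub (by omega), Nat.cast_one]
  rw [Hyperbolic.visualHausdorffDim_range ht0 hA hφ p, Hyperbolic.dimH_unitSphere (n - 1) hdim,
    hcast, ENNReal.ofReal_div_of_pos ht0]
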